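/- Let $n\ge 2$, $s\in(0,1)$ and $C(s)\ge 1$. For a domain $G\subsetneq\mathbb{R}^n$ let $\mathcal{H}^+(G)$ be the set of positive harmonic functions on $G$, and let $$h_G(x,y)=\sup_{u\in\mathcal{H}^+(G)}\left|\log\frac{u(x)}{u(y)}\right|,\qquad k_G(x,y)=\inf_\gamma\int_\gamma\frac{|dz|}{d(z,\partial G)},\qquad x,y\in G,$$ be the Harnack metric and the quasihyperbolic metric, where $\gamma$ runs over the rectifiable curves in $G$ joining $x$ and $y$. Suppose that $C(s)$ is a Harnack constant for $G$, that is, every $u\in\mathcal{H}^+(G)$ satisfies $$\max_{\overline{B}^n(z,sr)}u\le C(s)\min_{\overline{B}^n(z,sr)}u\qquad\text{whenever } r>0 \text{ and } B^n(z,r)\subset G.$$ (i) If $G$ is a proper subdomain of $\mathbb{R}^n$, then for all $x,y\in G$ $$h_G(x,y)\le\left(1+\frac{k_G(x,y)}{2\log(1+s)}\right)\log C(s).$$ (ii) If $G$ is the unit ball $\mathbb{B}^n$ or the half-space $\mathbb{H}^n=\{x\in\mathbb{R}^n: x_n>0\}$, then for all $x,y\in G$ $$h_G(x,y)\le\left(1+\frac{\rho_G(x,y)}{\log\frac{1+s}{1-s}}\right)\log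 C(s),$$ where $\rho_G$ is the hyperbolic metric, given by $\cosh\rho_{\mathbb{H}^n}(x,y)=1+\frac{|x-y|^2}{2x_ny_n}$ and $\sinh^2\frac{\rho_{\mathbb{B}^n}(x,y)}{2}=\frac{|x-y|^2}{(1-|x|^2)(1-|y|^2)}$. -/

import Mathlib

open scoped ENNReal

namespace HarnackMetric

noncomputable section

/-- A proper subdomain of `ℝⁿ`: a nonempty, open, connected set different from `ℝⁿ`. -/
def IsProperSubdomain {n : ℕ} (G : Set (EuclideanSpace ℝ (Fin n))) : Prop :=
  IsOpen G ∧ IsConnected G ∧ G ≠ Set.univ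

/-- The distance `d_G(x) = d(x, ∂G)` to the boundary. -/
def bdryDist {n : ℕ} (G : Set (EuclideanSpace ℝ (Fin n))) (x : EuclideanSpace ℝ (Fin n)) : ℝ :=
  Metric.infDist x (frontier G)

/-- The class `𝓗⁺(G)` of positive harmonic functions in `G` (for open `G`); only the values on `G`
matter. -/
def IsPositiveHarmonicOn {n : ℕ} (G : Set (EuclideanSpace ℝ (Fin n)))
    (u : EuclideanSpace ℝ (Fin n) → ℝ) : Prop :=
  InnerProductSpace.HarmonicOnNhd u G ∧ ∀ x ∈ G, 0 < u x

/-- The `(s, C)`-Harnack inequality in `G`: `u` is continuous and nonnegative on `G`, and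
`max u ≤ C * min u` on the closed ball of radius `s * r` around `x` whenever the open ball
`B(x, r)` lies in `G`. The supremum and infimum below are attained, by continuity and
compactness. -/
def SatisfiesHarnack {n : ℕ} (G : Set (EuclideanSpace ℝ (Fin n))) (s C : ℝ)
    (u : EuclideanSpace ℝ (Fin n) → ℝ) : Prop :=
  ContinuousOn u G ∧ (∀ x ∈ G, 0 ≤ u x) ∧
    ∀ (x : EuclideanSpace ℝ (Fin n)) (r : ℝ), 0 < r → Metric.ball x r ⊆ G →
      sSup (u '' Metric.closedBall x (s * r)) ≤ C * sInf (u '' Metric.closedBall x (s * r))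

/-- The Harnack (pseudo)metric `h_G(x, y) = sup |log (u x / u y)|`, the supremum over all positive
harmonic functions in `G`, taken in `[0, ∞]`. -/
def harnackDist {n : ℕ} (G : Set (EuclideanSpace ℝ (Fin n)))
    (x y : EuclideanSpace ℝ (Fin n)) : ℝ≥0∞ :=
  ⨆ (u : EuclideanSpace ℝ (Fin n) → ℝ) (_ : IsPositiveHarmonicOn G u),
    ENNReal.ofReal |Real.log (u x / u y)|

/-- The length `ℓ(γ)` of a curve, as an extended number. -/
def curveLength {n : ℕ} {x y : EuclideanSpace ℝ (Fin n)} (γ : Path x y) : ℝ≥0∞ :=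
  eVariationOn γ Set.univ

/-- The line integral `∫_γ w |dx|` of a weight `w ≥ 0` along a rectifiable curve `γ`, i.e. the
integral over `[0, ℓ(γ)]` of `w` along the arc-length parametrization of `γ`. -/
def lineIntegral {n : ℕ} (w : EuclideanSpace ℝ (Fin n) → ℝ≥0∞) {x y : EuclideanSpace ℝ (Fin n)}
    (γ : Path x y) : ℝ≥0∞ :=
  ∫⁻ t in Set.Icc (0 : ℝ) (curveLength γ).toReal, w (naturalParameterization γ Set.univ 0 t)

/-- The quasihyperbolic distance `k_G(x, y)`: the infimum of `∫_γ |dx| / d_G` over all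
rectifiable curves `γ` joining `x` and `y` in `G`. -/
def quasihypDist {n : ℕ} (G : Set (EuclideanSpace ℝ (Fin n)))
    (x y : EuclideanSpace ℝ (Fin n)) : ℝ≥0∞ :=
  ⨅ (γ : Path x y) (_ : Set.range γ ⊆ G) (_ : curveLength γ ≠ ⊤),
    lineIntegral (fun z => (ENNReal.ofReal (bdryDist G z))⁻¹) γ

/-- The unit ball `𝔹ⁿ`. -/
def unitBall (n : ℕ) : Set (EuclideanSpace ℝ (Fin n)) := Metric.ball 0 1

/-- The half-space `ℍⁿ = {x : x_n > 0}` (the last coordinate has index `n - 1`). -/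
def halfSpace (n : ℕ) (hn : 2 ≤ n) : Set (EuclideanSpace ℝ (Fin n)) :=
  {x | 0 < x ⟨n - 1, by omega⟩}

/-- The hyperbolic distance of `𝔹ⁿ`:
`sinh² (ρ/2) = |x - y|² / ((1 - |x|²) (1 - |y|²))`, for `x, y ∈ 𝔹ⁿ`. -/
def hypDistBall {n : ℕ} (x y : EuclideanSpace ℝ (Fin n)) : ℝ :=
  2 * Real.arsinh (‖x - y‖ / √((1 - ‖x‖ ^ 2) * (1 - ‖y‖ ^ 2)))

/-- The hyperbolic distance of `ℍⁿ`:
`cosh ρ = 1 + |x - y|² / (2 x_n y_n)`, for `x, y ∈ ℍⁿ`. -/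
def hypDistHalfSpace {n : ℕ} (hn : 2 ≤ n) (x y : EuclideanSpace ℝ (Fin n)) : ℝ :=
  Real.arcosh (1 + ‖x - y‖ ^ 2 / (2 * x ⟨n - 1, by omega⟩ * y ⟨n - 1, by omega⟩))

end

end HarnackMetric

/-! Two points of one ball `closedBall z (s * r)` with `ball z r ⊆ G` have values of `log u`
differing by at most `log C`. In each metric there is a length `M` such that the metric ball of
radius `M / 2` about any `m` lies in such a Euclidean ball. Two points at distance at most `M` are
both within `M / 2` of their midpoint, so `log u` changes by at most `log C` between them. Cutting a
path of length `D` into `⌊D / M⌋ + 1` pieces of length at most `M` gives the factor `1 + D / M`.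

For the hyperbolic metric `M / 2 = artanh s`: hyperbolic balls are Euclidean balls, and those of
this radius are exactly the concentric `s`-shrinkings of balls contained in `G`
(`exists_harnack_ball_halfSpace`, `exists_harnack_ball_unitBall`). Points dividing a segment are
written down through the hyperboloid model.

For the quasihyperbolic metric `M / 2 = log (1 + s)`, because `|z - m| ≤ (exp k - 1) d(m)`. No
geodesics are needed: the chain runs along an arbitrary rectifiable curve parametrized by arc
length, and the infimum over curves is taken last. -/

namespace HarnackMetric

/-! ### Harnack chains in an abstract distance -/

/-- If a function changes by at most `c` over steps of length at most `M`, and every distance can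
be split additively at any prescribed place, then it changes by at most `(N + 1) c` over distances
up to `(N + 1) M`. -/
theorem abs_sub_le_of_chain {X : Type*} {V : X → ℝ} {D : X → X → ℝ} {M c : ℝ} (hM : 0 < M)
    (hseg : ∀ x y t, 0 ≤ t → t ≤ D x y → ∃ m, D x m = t ∧ D m y = D x y - t)
    (hstep : ∀ x y, D x y ≤ M → |V x - V y| ≤ c) (N : ℕ) :
    ∀ x y, D x y ≤ (N + 1) * M → |V x - V y| ≤ (N + 1) * c := by
  have hc : ∀ x y, D x y ≤ M → 0 ≤ c := fun x y h => (abs_nonneg _).trans (hstep x y h)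
  induction N with
  | zero => intro x y h; simpa using hstep x y (by simpa using h)
  | succ N ih =>
    intro x y h
    push_cast at h ⊢
    rcases le_total M (D x y) with hM' | hM'
    · obtain ⟨m, h1, h2⟩ := hseg x y M hM.le hM'
      have h3 := hstep x m h1.le
      have h4 := ih m y (by rw [h2]; linarith)
      calc |V x - V y| ≤ |V x - V m| + |V m - V y| := abs_sub_le _ _ _
        _ ≤ c + (N + 1) * c := add_le_add h3 h4
        _ = _ := by ring
    · have h0 := hc x y hM'
      have := hstep x y hM'
      nlinarith [mul_nonneg (Nat.cast_nonneg (α := ℝ) N) h0]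

theorem abs_sub_le_one_add_div_mul {X : Type*} {V : X → ℝ} {D : X → X → ℝ} {M c : ℝ}
    (hM : 0 < M) (hc : 0 ≤ c) (hD : ∀ x y, 0 ≤ D x y)
    (hseg : ∀ x y t, 0 ≤ t → t ≤ D x y → ∃ m, D x m = t ∧ D m y = D x y - t)
    (hstep : ∀ x y, D x y ≤ M → |V x - V y| ≤ c) (x y : X) :
    |V x - V y| ≤ (1 + D x y / M) * c := by
  have h1 : D x y ≤ ((⌊D x y / M⌋₊ : ℝ) + 1) * M := by
    rw [← div_le_iff₀ hM]; exact (Nat.lt_floor_add_one _).le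
  refine (abs_sub_le_of_chain hM hseg hstep _ x y h1).trans ?_
  rw [add_comm 1]
  gcongr
  exact Nat.floor_le (div_nonneg (hD x y) hM.le)

theorem IsPositiveHarmonicOn.abs_log_sub_log_le {n : ℕ} {G : Set (EuclideanSpace ℝ (Fin n))}
    {s C : ℝ} {u : EuclideanSpace ℝ (Fin n) → ℝ} (hu : IsPositiveHarmonicOn G u)
    (hH : SatisfiesHarnack G s C u) (hs : s ∈ Set.Ioo (0 : ℝ) 1)
    {z a b : EuclideanSpace ℝ (Fin n)} {r : ℝ} (hr : 0 < r)
    (hz : Metric.ball z r ⊆ G) (ha : a ∈ Metric.closedBall z (s * r))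
    (hb : b ∈ Metric.closedBall z (s * r)) :
    |Real.log (u a) - Real.log (u b)| ≤ Real.log C := by
  have hsub : Metric.closedBall z (s * r) ⊆ G :=
    (Metric.closedBall_subset_ball (by nlinarith [hs.2])).trans hz
  have hK : IsCompact (u '' Metric.closedBall z (s * r)) :=
    (isCompact_closedBall z (s * r)).image_of_continuousOn (hH.1.mono hsub)
  have hsup := hH.2.2 z r hr hz
  have hne : (u '' Metric.closedBall z (s * r)).Nonempty := ⟨_, a, ha, rfl⟩
  have hC : 0 < C := by
    obtain ⟨w, hw, hw'⟩ := hK.sInf_mem hne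
    have h1 : 0 < sInf (u '' Metric.closedBall z (s * r)) := hw' ▸ hu.2 w (hsub hw)
    have h2 := le_csSup hK.bddAbove ⟨a, ha, rfl⟩
    exact pos_of_mul_pos_left ((hu.2 a (hsub ha)).trans_le (h2.trans hsup)) h1.le
  have key : ∀ p ∈ Metric.closedBall z (s * r), ∀ q ∈ Metric.closedBall z (s * r),
      Real.log (u p) - Real.log (u q) ≤ Real.log C := by
    intro p hp q hq
    have h1 : u p ≤ C * u q := (le_csSup hK.bddAbove ⟨p, hp, rfl⟩).trans
      (hsup.trans (mul_le_mul_of_nonneg_left (csInf_le hK.bddBelow ⟨q, hq, rfl⟩) hC.le))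
    have h2 := Real.log_le_log (hu.2 p (hsub hp)) h1
    rw [Real.log_mul hC.ne' (hu.2 q (hsub hq)).ne'] at h2
    linarith
  exact abs_le.2 ⟨by linarith [key b hb a ha], key a ha b hb⟩

theorem harnackDist_le {n : ℕ} {G : Set (EuclideanSpace ℝ (Fin n))}
    {x y : EuclideanSpace ℝ (Fin n)} (hx : x ∈ G) (hy : y ∈ G) {B : ℝ≥0∞}
    (h : ∀ u, IsPositiveHarmonicOn G u →
      ENNReal.ofReal |Real.log (u x) - Real.log (u y)| ≤ B) :
    harnackDist G x y ≤ B := by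
  refine iSup₂_le fun u hu => ?_
  rw [Real.log_div (hu.2 x hx).ne' (hu.2 y hy).ne']
  exact h u hu

/-- A geodesic-like distance on `G` whose pieces of length `M` lie in Harnack balls bounds the
Harnack metric. -/
theorem harnackDist_le_of_segments {n : ℕ} {G : Set (EuclideanSpace ℝ (Fin n))} {s C M : ℝ}
    (hs : s ∈ Set.Ioo (0 : ℝ) 1) (hC : 1 ≤ C) (hM : 0 < M)
    {D : EuclideanSpace ℝ (Fin n) → EuclideanSpace ℝ (Fin n) → ℝ}
    (hH : ∀ u, IsPositiveHarmonicOn G u → SatisfiesHarnack G s C u)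
    (hD : ∀ x ∈ G, ∀ y ∈ G, 0 ≤ D x y)
    (hseg : ∀ x ∈ G, ∀ y ∈ G, ∀ t, 0 ≤ t → t ≤ D x y →
      ∃ m ∈ G, D x m = t ∧ D m y = D x y - t)
    (hstep : ∀ x ∈ G, ∀ m ∈ G, ∀ y ∈ G, D x m ≤ M / 2 → D m y ≤ M / 2 →
      ∃ z r, 0 < r ∧ Metric.ball z r ⊆ G ∧ x ∈ Metric.closedBall z (s * r) ∧
        y ∈ Metric.closedBall z (s * r))
    {x y : EuclideanSpace ℝ (Fin n)} (hx : x ∈ G) (hy : y ∈ G) :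
    harnackDist G x y ≤ ENNReal.ofReal ((1 + D x y / M) * Real.log C) := by
  refine harnackDist_le hx hy fun u hu => ENNReal.ofReal_le_ofReal ?_
  refine abs_sub_le_one_add_div_mul (X := G) (V := fun p => Real.log (u p))
    (D := fun p q => D p q) hM (Real.log_nonneg hC) (fun p q => hD p p.2 q q.2) ?_ ?_
    ⟨x, hx⟩ ⟨y, hy⟩
  · intro p q t h0 h1
    obtain ⟨m, hm, h2⟩ := hseg p p.2 q q.2 t h0 h1
    exact ⟨⟨m, hm⟩, h2⟩
  · intro p q hpq
    have h0 := hD p p.2 q q.2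
    -- Centring the ball at the midpoint allows a step of twice its metric radius.
    obtain ⟨m, hm, h1, h2⟩ := hseg p p.2 q q.2 (D p q / 2) (by linarith) (by linarith)
    obtain ⟨z, r, hr, hz, ha, hb⟩ := hstep p p.2 m hm q q.2 (by linarith) (by linarith)
    exact hu.abs_log_sub_log_le (hH u hu) hs hr hz ha hb

/-! ### Hyperbolic interpolation and the radius `artanh s` -/

/-- The weights of the geodesic interpolation between two points at distance `R` in the
hyperboloid model. -/
theorem exists_hyperbolic_weights {R t : ℝ} (hR : 0 < R) (h0 : 0 ≤ t) (h1 : t ≤ R) :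
    ∃ α β : ℝ, 0 ≤ α ∧ 0 ≤ β ∧ 0 < α + β ∧
      α ^ 2 + β ^ 2 + 2 * α * β * Real.cosh R = 1 ∧
      Real.cosh t = α + β * Real.cosh R ∧ Real.cosh (R - t) = β + α * Real.cosh R := by
  have hS : 0 < Real.sinh R := Real.sinh_pos_iff.2 hR
  have hα : 0 ≤ Real.sinh (R - t) / Real.sinh R :=
    div_nonneg (Real.sinh_nonneg_iff.2 (by linarith)) hS.le
  have hβ : 0 ≤ Real.sinh t / Real.sinh R := div_nonneg (Real.sinh_nonneg_iff.2 h0) hS.le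
  have e1 := Real.cosh_sq R
  have e2 := Real.cosh_sq t
  -- For unit vectors `X`, `Y` of the hyperboloid with Lorentz product `-cosh R`, this says that `αX
  -- + βY` is again on the hyperboloid.
  have hq : (Real.sinh (R - t) / Real.sinh R) ^ 2 + (Real.sinh t / Real.sinh R) ^ 2 +
      2 * (Real.sinh (R - t) / Real.sinh R) * (Real.sinh t / Real.sinh R) * Real.cosh R = 1 := by
    rw [Real.sinh_sub]
    field_simp
    linear_combination (Real.sinh R) ^ 2 * e2 - (Real.sinh t) ^ 2 * e1
  refine ⟨_, _, hα, hβ, ?_, hq, ?_, ?_⟩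
  · rcases (add_nonneg hα hβ).lt_or_eq with h | h
    · exact h
    · have a0 : Real.sinh (R - t) / Real.sinh R = 0 := by linarith
      have b0 : Real.sinh t / Real.sinh R = 0 := by linarith
      rw [a0, b0] at hq
      norm_num at hq
  · rw [Real.sinh_sub]; field_simp; ring
  · rw [Real.sinh_sub, Real.cosh_sub]; field_simp; linear_combination Real.sinh t * e1

/-- Half of the logarithm is `artanh s`, so this is `cosh² (1 - tanh²) = 1`. -/
theorem cosh_half_log_sq {s : ℝ} (hs : s ∈ Set.Ioo (0 : ℝ) 1) :
    Real.cosh (Real.log ((1 + s) / (1 - s)) / 2) ^ 2 * (1 - s ^ 2) = 1 := by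
  have h1 : 0 < 1 + s := by linarith [hs.1]
  have h2 : 0 < 1 - s := by linarith [hs.2]
  have h := Real.cosh_two_mul (Real.log ((1 + s) / (1 - s)) / 2)
  rw [mul_div_cancel₀ _ two_ne_zero, Real.cosh_log (by positivity), Real.sinh_sq] at h
  have h3 : Real.cosh (Real.log ((1 + s) / (1 - s)) / 2) ^ 2
      = (((1 + s) / (1 - s) + ((1 + s) / (1 - s))⁻¹) / 2 + 1) / 2 := by linarith
  rw [h3]
  field_simp
  ring

theorem log_ratio_pos {s : ℝ} (hs : s ∈ Set.Ioo (0 : ℝ) 1) :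
    0 < Real.log ((1 + s) / (1 - s)) := by
  apply Real.log_pos
  rw [one_lt_div (by linarith [hs.2])]
  linarith [hs.1]

theorem cosh_eq_cosh_of_nonneg {a b : ℝ} (ha : 0 ≤ a) (hb : 0 ≤ b)
    (h : Real.cosh a = Real.cosh b) : a = b :=
  Real.cosh_injOn ha hb h

/-! ### The half-space -/

section HalfSpace

variable {n : ℕ}

theorem norm_smul_add_smul_single_sq (i : Fin n) (p : EuclideanSpace ℝ (Fin n)) (a b : ℝ) :
    ‖a • p + b • EuclideanSpace.single i (1 : ℝ)‖ ^ 2 =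
      a ^ 2 * ‖p‖ ^ 2 + 2 * a * b * p i + b ^ 2 := by
  rw [norm_add_sq_real, norm_smul, norm_smul, inner_smul_left, inner_smul_right,
    EuclideanSpace.inner_single_right, PiLp.norm_single]
  simp only [Real.norm_eq_abs, mul_pow, sq_abs, conj_trivial]
  norm_num
  ring

theorem cosh_hypDistHalfSpace (hn : 2 ≤ n) {x y : EuclideanSpace ℝ (Fin n)}
    (hx : x ∈ halfSpace n hn) (hy : y ∈ halfSpace n hn) :
    Real.cosh (hypDistHalfSpace hn x y) =
      1 + ‖x - y‖ ^ 2 / (2 * x ⟨n - 1, by omega⟩ * y ⟨n - 1, by omega⟩) := by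
  have hx' : 0 < x ⟨n - 1, by omega⟩ := hx
  have hy' : 0 < y ⟨n - 1, by omega⟩ := hy
  exact Real.cosh_arcosh (le_add_of_nonneg_right (by positivity))

theorem hypDistHalfSpace_nonneg (hn : 2 ≤ n) {x y : EuclideanSpace ℝ (Fin n)}
    (hx : x ∈ halfSpace n hn) (hy : y ∈ halfSpace n hn) : 0 ≤ hypDistHalfSpace hn x y := by
  have hx' : 0 < x ⟨n - 1, by omega⟩ := hx
  have hy' : 0 < y ⟨n - 1, by omega⟩ := hy
  exact Real.arcosh_nonneg (le_add_of_nonneg_right (by positivity))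

/-- `h`, `k`, `H` are the heights of `x`, `y` and the interpolated point `m`, and `A = |x - y|²`.
The left side expands `|m - x|²`; the right side is the value that the formula for `cosh ρ` demands,
since `α + βc = cosh t`. -/
theorem halfSpace_interpolation_identity {α β c h k H A : ℝ} (hh : 0 < h) (hk : 0 < k)
    (hH : H * (α / h + β / k) = 1) (hA : c = 1 + A / (2 * h * k))
    (hq : α ^ 2 + β ^ 2 + 2 * α * β * c = 1) :
    (β * H / k) ^ 2 * A + 2 * (β * H / k) * (H * (1 - α - β)) * (k - h) +
      (H * (1 - α - β)) ^ 2 = 2 * h * H * (α + β * c - 1) := by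
  have hA' : A = 2 * h * k * (c - 1) := by rw [hA]; field_simp; ring
  have e : 2 * h * H * (α + β * c - 1) =
      2 * h * H * (α + β * c - 1) * (H * (α / h + β / k)) := by rw [hH, mul_one]
  rw [e, hA']
  field_simp
  linear_combination (-H ^ 2 * k) * hq

theorem exists_segment_halfSpace (hn : 2 ≤ n) {x y : EuclideanSpace ℝ (Fin n)}
    (hx : x ∈ halfSpace n hn) (hy : y ∈ halfSpace n hn) {t : ℝ} (h0 : 0 ≤ t)
    (h1 : t ≤ hypDistHalfSpace hn x y) :
    ∃ m ∈ halfSpace n hn, hypDistHalfSpace hn x m = t ∧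
      hypDistHalfSpace hn m y = hypDistHalfSpace hn x y - t := by
  rcases (hypDistHalfSpace_nonneg hn hx hy).eq_or_lt with hR | hR
  · have ht : t = 0 := le_antisymm (hR ▸ h1) h0
    exact ⟨x, hx, by simp [hypDistHalfSpace, ht], by simp [ht]⟩
  obtain ⟨α, β, hα, hβ, hαβ, hq, ht1, ht2⟩ := exists_hyperbolic_weights hR h0 h1
  have hcR := cosh_hypDistHalfSpace hn hx hy
  set R := hypDistHalfSpace hn x y
  set i : Fin n := ⟨n - 1, by omega⟩
  have hh : 0 < x i := hx
  have hk : 0 < y i := hy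
  have hden : 0 < α / x i + β / y i := by
    rcases hα.eq_or_lt with h | h
    · have : 0 < β := by linarith
      positivity
    · positivity
  -- The reciprocal height and the horizontal part divided by the height are linear coordinates on
  -- the hyperboloid. Hence `αX + βY` has reciprocal height `α / x i + β / y i`, and its horizontal
  -- part is a convex combination of those of `x` and `y`. The vertical term in `m` corrects the
  -- height to `H`.
  set H := (α / x i + β / y i)⁻¹ with hHdef
  have hHpos : 0 < H := inv_pos.2 hden
  have hH : H * (α / x i + β / y i) = 1 := inv_mul_cancel₀ hden.ne'
  have hsum : α * H / x i + β * H / y i = 1 := by rw [← hH]; ring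
  set m : EuclideanSpace ℝ (Fin n) := x + ((β * H / y i) • (y - x) +
    (H * (1 - α - β)) • EuclideanSpace.single i (1 : ℝ)) with hm
  have hmi : m i = H := by
    have : m i = x i + (β * H / y i * (y i - x i) + H * (1 - α - β)) := by simp [hm]
    rw [this]
    have e : x i - β * H / y i * x i = α * H := by
      have : 1 - β * H / y i = α * H / x i := by linarith
      calc _ = (1 - β * H / y i) * x i := by ring
        _ = α * H := by rw [this]; field_simp
    have e2 : β * H / y i * y i = β * H := by field_simp
    linear_combination e + e2
  have hmG : m ∈ halfSpace n hn := by change 0 < m i; rw [hmi]; exact hHpos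
  have hA : ‖y - x‖ = ‖x - y‖ := norm_sub_rev _ _
  have dx : ‖x - m‖ ^ 2 = 2 * x i * H * (α + β * Real.cosh R - 1) := by
    rw [← halfSpace_interpolation_identity hh hk hH hcR hq, norm_sub_rev,
      show m - x = (β * H / y i) • (y - x) +
        (H * (1 - α - β)) • EuclideanSpace.single i (1 : ℝ) by rw [hm]; abel,
      norm_smul_add_smul_single_sq, hA]
    rfl
  have dy : ‖m - y‖ ^ 2 = 2 * y i * H * (β + α * Real.cosh R - 1) := by
    rw [← halfSpace_interpolation_identity (h := y i) (k := x i) (A := ‖x - y‖ ^ 2) hk hh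
      (by rw [add_comm]; exact hH) (by rw [hcR]; ring) (by linarith),
      show m - y = (α * H / x i) • (x - y) +
        (H * (1 - β - α)) • EuclideanSpace.single i (1 : ℝ) by
          rw [hm, show α * H / x i = 1 - β * H / y i by linarith,
            show H * (1 - β - α) = H * (1 - α - β) by ring]
          module,
      norm_smul_add_smul_single_sq]
    rfl
  refine ⟨m, hmG, cosh_eq_cosh_of_nonneg (hypDistHalfSpace_nonneg hn hx hmG) h0 ?_,
    cosh_eq_cosh_of_nonneg (hypDistHalfSpace_nonneg hn hmG hy) (by linarith) ?_⟩
  · rw [cosh_hypDistHalfSpace hn hx hmG, ht1]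
    change 1 + ‖x - m‖ ^ 2 / (2 * x i * m i) = _
    rw [dx, hmi]; field_simp; ring
  · rw [cosh_hypDistHalfSpace hn hmG hy, ht2]
    change 1 + ‖m - y‖ ^ 2 / (2 * m i * y i) = _
    rw [dy, hmi]; field_simp; ring

theorem hypDistHalfSpace_comm (hn : 2 ≤ n) (x y : EuclideanSpace ℝ (Fin n)) :
    hypDistHalfSpace hn x y = hypDistHalfSpace hn y x := by
  unfold hypDistHalfSpace
  rw [norm_sub_rev, mul_right_comm]

/-- Hyperbolic balls of radius `artanh s` in the half-space lie in Harnack balls. -/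
theorem exists_harnack_ball_halfSpace (hn : 2 ≤ n) {s : ℝ} (hs : s ∈ Set.Ioo (0 : ℝ) 1)
    {m : EuclideanSpace ℝ (Fin n)} (hm : m ∈ halfSpace n hn) :
    ∃ z r, 0 < r ∧ Metric.ball z r ⊆ halfSpace n hn ∧ ∀ x ∈ halfSpace n hn,
      hypDistHalfSpace hn x m ≤ Real.log ((1 + s) / (1 - s)) / 2 →
        x ∈ Metric.closedBall z (s * r) := by
  have hcs := cosh_half_log_sq hs
  have hM := log_ratio_pos hs
  set M := Real.log ((1 + s) / (1 - s))
  set c := Real.cosh (M / 2)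
  have hc : 1 ≤ c := Real.one_le_cosh _
  set i : Fin n := ⟨n - 1, by omega⟩ with hi
  have hmi : 0 < m i := hm
  -- The hyperbolic ball of radius `M / 2` about `m` is the Euclidean ball with centre raised to
  -- height `c * m i` and radius `m i * sinh (M / 2) = s * (c * m i)`, since `tanh (M / 2) = s`. The
  -- ball of radius `c * m i` just touches the boundary.
  refine ⟨m + ((c - 1) * m i) • EuclideanSpace.single i (1 : ℝ), c * m i, by positivity, ?_, ?_⟩
  · intro w hw
    rw [Metric.mem_ball, dist_eq_norm] at hw
    have h1 := PiLp.norm_apply_le (w - (m + ((c - 1) * m i) • EuclideanSpace.single i (1 : ℝ))) i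
    have h2 : (w - (m + ((c - 1) * m i) • EuclideanSpace.single i (1 : ℝ))) i
        = w i - c * m i := by
      simp; ring
    rw [h2, Real.norm_eq_abs] at h1
    change 0 < w i
    linarith [(abs_lt.1 (h1.trans_lt hw)).1]
  · intro x hx hd
    have hxi : 0 < x i := hx
    rw [Metric.mem_closedBall, dist_eq_norm]
    have hs0 := hs.1
    refine (pow_le_pow_iff_left₀ (norm_nonneg _) (by positivity) two_ne_zero).1 ?_
    have hch : Real.cosh (hypDistHalfSpace hn x m) ≤ c := by
      rw [Real.cosh_le_cosh, abs_of_nonneg (hypDistHalfSpace_nonneg hn hx hm),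
        abs_of_pos (by positivity)]
      exact hd
    rw [cosh_hypDistHalfSpace hn hx hm] at hch
    change 1 + ‖x - m‖ ^ 2 / (2 * x i * m i) ≤ c at hch
    have h3 : ‖x - m‖ ^ 2 ≤ (c - 1) * (2 * x i * m i) := by
      rw [← div_le_iff₀ (by positivity)]; linarith
    rw [show x - (m + ((c - 1) * m i) • EuclideanSpace.single i (1 : ℝ)) =
      (1 : ℝ) • (x - m) + (-((c - 1) * m i)) • EuclideanSpace.single i (1 : ℝ) by module,
      norm_smul_add_smul_single_sq]
    have h4 : (x - m) i = x i - m i := rfl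
    rw [h4]
    linear_combination h3 + (m i) ^ 2 * hcs

theorem harnackDist_halfSpace_le (hn : 2 ≤ n) {s C : ℝ} (hs : s ∈ Set.Ioo (0 : ℝ) 1)
    (hC : 1 ≤ C)
    (hH : ∀ u, IsPositiveHarmonicOn (halfSpace n hn) u → SatisfiesHarnack (halfSpace n hn) s C u)
    {x y : EuclideanSpace ℝ (Fin n)} (hx : x ∈ halfSpace n hn) (hy : y ∈ halfSpace n hn) :
    harnackDist (halfSpace n hn) x y ≤
      ENNReal.ofReal ((1 + hypDistHalfSpace hn x y / Real.log ((1 + s) / (1 - s))) *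
        Real.log C) := by
  refine harnackDist_le_of_segments hs hC (log_ratio_pos hs) hH
    (fun x hx y hy => hypDistHalfSpace_nonneg hn hx hy)
    (fun x hx y hy t h0 h1 => exists_segment_halfSpace hn hx hy h0 h1) ?_ hx hy
  intro x hx m hm y hy h1 h2
  obtain ⟨z, r, hr, hz, h⟩ := exists_harnack_ball_halfSpace hn hs hm
  exact ⟨z, r, hr, hz, h x hx h1, h y hy (hypDistHalfSpace_comm hn y m ▸ h2)⟩

end HalfSpace

/-! ### The unit ball -/

section UnitBall

variable {n : ℕ}

theorem norm_sq_lt_one_of_mem_unitBall {x : EuclideanSpace ℝ (Fin n)} (hx : x ∈ unitBall n) :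
    ‖x‖ ^ 2 < 1 := by
  have : ‖x‖ < 1 := by simpa [unitBall] using hx
  nlinarith [norm_nonneg x]

theorem cosh_hypDistBall {x y : EuclideanSpace ℝ (Fin n)}
    (hx : x ∈ unitBall n) (hy : y ∈ unitBall n) :
    Real.cosh (hypDistBall x y) =
      1 + 2 * ‖x - y‖ ^ 2 / ((1 - ‖x‖ ^ 2) * (1 - ‖y‖ ^ 2)) := by
  have hx' : 0 < 1 - ‖x‖ ^ 2 := by linarith [norm_sq_lt_one_of_mem_unitBall hx]
  have hy' : 0 < 1 - ‖y‖ ^ 2 := by linarith [norm_sq_lt_one_of_mem_unitBall hy]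
  rw [hypDistBall, Real.cosh_two_mul, Real.cosh_sq, Real.sinh_arsinh, div_pow,
    Real.sq_sqrt (by positivity)]
  ring

theorem hypDistBall_nonneg (x y : EuclideanSpace ℝ (Fin n)) : 0 ≤ hypDistBall x y :=
  mul_nonneg zero_le_two (Real.arsinh_nonneg_iff.2 (by positivity))

theorem hypDistBall_comm (x y : EuclideanSpace ℝ (Fin n)) :
    hypDistBall x y = hypDistBall y x := by
  unfold hypDistBall
  rw [norm_sub_rev, mul_comm (1 - ‖x‖ ^ 2)]

theorem norm_smul_add_smul_sq (x y : EuclideanSpace ℝ (Fin n)) (a b : ℝ) :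
    ‖a • x + b • y‖ ^ 2 = a ^ 2 * ‖x‖ ^ 2 + 2 * a * b * inner ℝ x y + b ^ 2 * ‖y‖ ^ 2 := by
  rw [norm_add_sq_real, norm_smul, norm_smul, inner_smul_left, inner_smul_right]
  simp only [Real.norm_eq_abs, mul_pow, sq_abs, conj_trivial]
  ring

/-- Here `X`, `Y`, `I` are the entries of the Gram matrix of the two end points, and
`a = 1 / (1 - X)`, `b = 1 / (1 - Y)`. -/
theorem ball_interpolation_identity {α β c X Y I a b : ℝ} (hX : a * (1 - X) = 1)
    (hY : b * (1 - Y) = 1) (hc : c = 1 + 2 * (X + Y - 2 * I) * (a * b))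
    (hq : α ^ 2 + β ^ 2 + 2 * α * β * c = 1) :
    4 * ((α * a) ^ 2 * X + 2 * (α * a) * (β * b) * I + (β * b) ^ 2 * Y) =
      (α * (2 * a - 1) + β * (2 * b - 1)) ^ 2 - 1 := by
  have hX' : a * X = a - 1 := by linarith
  have hY' : b * Y = b - 1 := by linarith
  have hI : 4 * (a * b) * I = 1 - c + 2 * (a * X * b + b * Y * a) := by rw [hc]; ring
  rw [hX', hY'] at hI
  linear_combination 4 * α ^ 2 * a * hX' + 4 * β ^ 2 * b * hY' + 2 * α * β * hI - hq

theorem exists_segment_unitBall {x y : EuclideanSpace ℝ (Fin n)}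
    (hx : x ∈ unitBall n) (hy : y ∈ unitBall n) {t : ℝ} (h0 : 0 ≤ t)
    (h1 : t ≤ hypDistBall x y) :
    ∃ m ∈ unitBall n, hypDistBall x m = t ∧ hypDistBall m y = hypDistBall x y - t := by
  rcases (hypDistBall_nonneg x y).eq_or_lt with hR | hR
  · have ht : t = 0 := le_antisymm (hR ▸ h1) h0
    exact ⟨x, hx, by simp [hypDistBall, ht], by simp [ht]⟩
  obtain ⟨α, β, hα, hβ, hαβ, hq, ht1, ht2⟩ := exists_hyperbolic_weights hR h0 h1
  have hcR := cosh_hypDistBall hx hy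
  set R := hypDistBall x y
  have hX : 0 < 1 - ‖x‖ ^ 2 := by linarith [norm_sq_lt_one_of_mem_unitBall hx]
  have hY : 0 < 1 - ‖y‖ ^ 2 := by linarith [norm_sq_lt_one_of_mem_unitBall hy]
  obtain ⟨a, ha⟩ : ∃ a, a = (1 - ‖x‖ ^ 2)⁻¹ := ⟨_, rfl⟩
  obtain ⟨b, hb⟩ : ∃ b, b = (1 - ‖y‖ ^ 2)⁻¹ := ⟨_, rfl⟩
  have haX : a * (1 - ‖x‖ ^ 2) = 1 := by rw [ha]; exact inv_mul_cancel₀ hX.ne'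
  have hbY : b * (1 - ‖y‖ ^ 2) = 1 := by rw [hb]; exact inv_mul_cancel₀ hY.ne'
  have ha1 : 1 ≤ a := by rw [ha]; exact (one_le_inv₀ hX).2 (by linarith [sq_nonneg ‖x‖])
  have hb1 : 1 ≤ b := by rw [hb]; exact (one_le_inv₀ hY).2 (by linarith [sq_nonneg ‖y‖])
  have hc : Real.cosh R = 1 + 2 * (‖x‖ ^ 2 + ‖y‖ ^ 2 - 2 * inner ℝ x y) * (a * b) := by
    rw [hcR, norm_sub_sq_real, div_eq_mul_inv, mul_inv, ha, hb]; ring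
  have hid := ball_interpolation_identity haX hbY hc hq
  -- A point `x` lifts to the hyperboloid as `(2a - 1, 2a x)`. So `P` is the time component of `αX +
  -- βY`, and `hid` says that this combination has Lorentz norm `-1`.
  set P := α * (2 * a - 1) + β * (2 * b - 1) with hP
  have hPpos : 0 < P := by nlinarith
  have hQ : 0 < P + 1 := by linarith
  -- Stereographic projection back to the ball divides the space component by `P + 1`.
  set m : EuclideanSpace ℝ (Fin n) :=
    (2 * (α * a) / (P + 1)) • x + (2 * (β * b) / (P + 1)) • y with hm
  have hmsq : ‖m‖ ^ 2 = (P - 1) / (P + 1) := by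
    rw [hm, norm_smul_add_smul_sq, eq_div_iff hQ.ne']
    field_simp
    linear_combination hid
  have h1m : 1 - ‖m‖ ^ 2 = 2 / (P + 1) := by rw [hmsq]; field_simp; ring
  have hmG : m ∈ unitBall n := by
    have : 0 < 1 - ‖m‖ ^ 2 := by rw [h1m]; positivity
    rw [unitBall, mem_ball_zero_iff]
    nlinarith [norm_nonneg m]
  have hX' : a * ‖x‖ ^ 2 = a - 1 := by linarith
  have hY' : b * ‖y‖ ^ 2 = b - 1 := by linarith
  have hI : 4 * (a * b) * inner ℝ x y = 1 - Real.cosh R + 2 * (a * ‖x‖ ^ 2 * b +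
    b * ‖y‖ ^ 2 * a) := by rw [hc]; ring
  rw [hX', hY'] at hI
  have dx : 2 * ‖x - m‖ ^ 2 / ((1 - ‖x‖ ^ 2) * (1 - ‖m‖ ^ 2)) = α + β * Real.cosh R - 1 := by
    rw [norm_sub_sq_real, div_eq_mul_inv, mul_inv, ← ha, h1m, hmsq, hm, inner_add_right,
      inner_smul_right, inner_smul_right, real_inner_self_eq_norm_sq]
    field_simp
    linear_combination (P + 1 - 4 * α * a) * hX' - β * hI + hP
  have dy : 2 * ‖m - y‖ ^ 2 / ((1 - ‖m‖ ^ 2) * (1 - ‖y‖ ^ 2)) = β + α * Real.cosh R - 1 := by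
    rw [norm_sub_sq_real, div_eq_mul_inv, mul_inv, ← hb, h1m, hmsq, hm, inner_add_left,
      inner_smul_left, inner_smul_left, real_inner_self_eq_norm_sq]
    simp only [conj_trivial]
    field_simp
    linear_combination (P + 1 - 4 * β * b) * hY' - α * hI + hP
  refine ⟨m, hmG, cosh_eq_cosh_of_nonneg (hypDistBall_nonneg _ _) h0 ?_,
    cosh_eq_cosh_of_nonneg (hypDistBall_nonneg _ _) (by linarith) ?_⟩
  · rw [cosh_hypDistBall hx hmG, ht1, dx]; ring
  · rw [cosh_hypDistBall hmG hy, ht2, dy]; ring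

/-- Hyperbolic balls of radius `artanh s` in the unit ball lie in Harnack balls. -/
theorem exists_harnack_ball_unitBall {s : ℝ} (hs : s ∈ Set.Ioo (0 : ℝ) 1)
    {m : EuclideanSpace ℝ (Fin n)} (hm : m ∈ unitBall n) :
    ∃ z r, 0 < r ∧ Metric.ball z r ⊆ unitBall n ∧ ∀ x ∈ unitBall n,
      hypDistBall x m ≤ Real.log ((1 + s) / (1 - s)) / 2 →
        x ∈ Metric.closedBall z (s * r) := by
  have hcs := cosh_half_log_sq hs
  have hM := log_ratio_pos hs
  have hs0 := hs.1
  set M := Real.log ((1 + s) / (1 - s))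
  set c := Real.cosh (M / 2)
  have hc : 1 ≤ c := Real.one_le_cosh _
  have hμ : 0 < 1 - ‖m‖ ^ 2 := by linarith [norm_sq_lt_one_of_mem_unitBall hm]
  have hm1 : ‖m‖ < 1 := by simpa [unitBall] using hm
  have hm0 := norm_nonneg m
  obtain ⟨D, hD⟩ : ∃ D, D = 1 + (c - 1) / 2 * (1 - ‖m‖ ^ 2) := ⟨_, rfl⟩
  have hDpos : 0 < D := by rw [hD]; nlinarith
  -- `D⁻¹ • m` is the Euclidean centre of the hyperbolic ball of radius `M / 2` about `m`. Its
  -- Euclidean radius is `(1 - ‖m‖²) sinh (M / 2) / (2D)`, which is `s * r` because `sinh (M / 2) =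
  -- s * c`.
  refine ⟨D⁻¹ • m, (1 - ‖m‖ ^ 2) * c / (2 * D), by positivity, ?_, ?_⟩
  · apply Metric.ball_subset_ball'
    rw [dist_zero_right, norm_smul, Real.norm_eq_abs, abs_of_pos (inv_pos.2 hDpos)]
    have : (1 - ‖m‖ ^ 2) * c / (2 * D) + D⁻¹ * ‖m‖ = ((1 - ‖m‖ ^ 2) * c / 2 + ‖m‖) / D := by
      field_simp
    rw [this, div_le_one hDpos, hD]
    -- The terms in `c` cancel, leaving `2‖m‖ ≤ 1 + ‖m‖²`.
    nlinarith [sq_nonneg (1 - ‖m‖)]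
  · intro x hx hd
    have hX : 0 < 1 - ‖x‖ ^ 2 := by linarith [norm_sq_lt_one_of_mem_unitBall hx]
    rw [Metric.mem_closedBall, dist_eq_norm]
    refine (pow_le_pow_iff_left₀ (norm_nonneg _) (by positivity) two_ne_zero).1 ?_
    have hch : Real.cosh (hypDistBall x m) ≤ c := by
      rw [Real.cosh_le_cosh, abs_of_nonneg (hypDistBall_nonneg x m), abs_of_pos (by positivity)]
      exact hd
    rw [cosh_hypDistBall hx hm] at hch
    have h3 : 2 * ‖x - m‖ ^ 2 ≤ (c - 1) * ((1 - ‖x‖ ^ 2) * (1 - ‖m‖ ^ 2)) := by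
      rw [← div_le_iff₀ (by positivity)]; linarith
    rw [norm_sub_sq_real] at h3
    have e : s ^ 2 * c ^ 2 = c ^ 2 - 1 := by linarith
    have e1 : (s * ((1 - ‖m‖ ^ 2) * c / (2 * D))) ^ 2 =
        (1 - ‖m‖ ^ 2) ^ 2 * (c ^ 2 - 1) / (4 * D ^ 2) := by
      rw [← e]; field_simp; ring
    rw [e1, norm_sub_sq_real, inner_smul_right, norm_smul, Real.norm_eq_abs,
      abs_of_pos (inv_pos.2 hDpos), le_div_iff₀ (by positivity)]
    have e2 : (‖x‖ ^ 2 - 2 * (D⁻¹ * inner ℝ x m) + (D⁻¹ * ‖m‖) ^ 2) * (4 * D ^ 2) =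
        4 * (D * (D * ‖x‖ ^ 2 - 2 * inner ℝ x m) + ‖m‖ ^ 2) := by
      field_simp
    -- This is `h3` with the terms in `‖x‖²` collected; completing the square gives a ball about
    -- `D⁻¹ • m`.
    have h4 : D * ‖x‖ ^ 2 - 2 * inner ℝ x m ≤ D - 1 - ‖m‖ ^ 2 := by
      rw [hD]; linarith
    have h5 := mul_le_mul_of_nonneg_left h4 hDpos.le
    rw [e2]
    calc _ ≤ 4 * (D * (D - 1 - ‖m‖ ^ 2) + ‖m‖ ^ 2) := by linarith
      _ = _ := by rw [hD]; ring

theorem harnackDist_unitBall_le {s C : ℝ} (hs : s ∈ Set.Ioo (0 : ℝ) 1) (hC : 1 ≤ C)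
    (hH : ∀ u, IsPositiveHarmonicOn (unitBall n) u → SatisfiesHarnack (unitBall n) s C u)
    {x y : EuclideanSpace ℝ (Fin n)} (hx : x ∈ unitBall n) (hy : y ∈ unitBall n) :
    harnackDist (unitBall n) x y ≤
      ENNReal.ofReal ((1 + hypDistBall x y / Real.log ((1 + s) / (1 - s))) * Real.log C) := by
  refine harnackDist_le_of_segments hs hC (log_ratio_pos hs) hH
    (fun x _ y _ => hypDistBall_nonneg x y)
    (fun x hx y hy t h0 h1 => exists_segment_unitBall hx hy h0 h1) ?_ hx hy
  intro x hx m hm y hy h1 h2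
  obtain ⟨z, r, hr, hz, h⟩ := exists_harnack_ball_unitBall hs hm
  exact ⟨z, r, hr, hz, h x hx h1, h y hy (hypDistBall_comm y m ▸ h2)⟩

end UnitBall

/-! ### Arc-length parametrization -/

/-- By additivity the base point can be moved to `x`; for left continuity, the variation over `[y,
x]` tends to `0` as `y` increases to `x`. Continuity ensures that every value between `0` and the
length is attained as an arc length. -/
theorem _root_.BoundedVariationOn.continuous_variationOnFromTo {α E : Type*} [LinearOrder α]
    [TopologicalSpace α] [OrderTopology α] [PseudoEMetricSpace E] {f : α → E}
    (hf : BoundedVariationOn f Set.univ) (hc : Continuous f) (a : α) :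
    Continuous (variationOnFromTo f Set.univ a) := by
  rw [continuous_iff_continuousAt]
  intro x
  rw [continuousAt_iff_continuous_left_right]
  refine ⟨?_, hf.continuousWithinAt_variationOnFromTo_Ici hc.continuousWithinAt⟩
  have h : variationOnFromTo f Set.univ a =
      fun y => variationOnFromTo f Set.univ a x + variationOnFromTo f Set.univ x y := by
    ext y
    rw [variationOnFromTo.add hf.locallyBoundedVariationOn (Set.mem_univ _) (Set.mem_univ _)
      (Set.mem_univ _)]
  rw [h]
  refine continuousWithinAt_const.add ?_
  suffices H : ContinuousWithinAt (fun y => -(eVariationOn f (Set.univ ∩ Set.Icc y x)).toReal)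
      (Set.Iic x) x from
    H.congr_of_mem (fun y hy => variationOnFromTo.eq_of_ge _ _ hy) Set.self_mem_Iic
  refine ContinuousWithinAt.neg ?_
  simp only [ContinuousWithinAt, Set.Icc_self]
  rw [eVariationOn.subsingleton _ (by simp)]
  refine (ENNReal.tendsto_toReal ENNReal.zero_ne_top).comp ?_
  refine Filter.Tendsto.mono_left ?_ (nhdsWithin_mono _ (Set.subset_univ _))
  exact hf.tendsto_eVariationOn_Icc_zero_left hc.continuousWithinAt

section ArcLength

variable {n : ℕ} {x y : EuclideanSpace ℝ (Fin n)} (γ : Path x y)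

theorem naturalParameterization_variation (hγ : curveLength γ ≠ ⊤) (b : unitInterval) :
    naturalParameterization γ Set.univ 0 (variationOnFromTo γ Set.univ 0 b) = γ b :=
  edist_eq_zero.1 (edist_naturalParameterization_eq_zero
    (BoundedVariationOn.locallyBoundedVariationOn hγ) (Set.mem_univ _) (Set.mem_univ _))

theorem variation_path_one : variationOnFromTo γ Set.univ 0 1 = (curveLength γ).toReal := by
  rw [variationOnFromTo.eq_of_le _ _ zero_le_one, curveLength, Set.univ_inter,
    show Set.Icc (0 : unitInterval) 1 = Set.univ from Set.Icc_bot_top]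

theorem naturalParameterization_zero (hγ : curveLength γ ≠ ⊤) :
    naturalParameterization γ Set.univ 0 0 = x := by
  have := naturalParameterization_variation γ hγ 0
  rwa [variationOnFromTo.self, γ.source] at this

theorem naturalParameterization_length (hγ : curveLength γ ≠ ⊤) :
    naturalParameterization γ Set.univ 0 (curveLength γ).toReal = y := by
  have := naturalParameterization_variation γ hγ 1
  rwa [variation_path_one, γ.target] at this

theorem exists_variation_eq (hγ : curveLength γ ≠ ⊤) {t : ℝ}
    (ht : t ∈ Set.Icc 0 (curveLength γ).toReal) :
    ∃ b, variationOnFromTo γ Set.univ 0 b = t := by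
  have hc : Continuous (variationOnFromTo γ Set.univ 0) :=
    BoundedVariationOn.continuous_variationOnFromTo hγ γ.continuous 0
  exact mem_range_of_exists_le_of_exists_ge hc
    ⟨0, by rw [variationOnFromTo.self]; exact ht.1⟩ ⟨1, by rw [variation_path_one]; exact ht.2⟩

theorem naturalParameterization_mem_range (hγ : curveLength γ ≠ ⊤) {t : ℝ}
    (ht : t ∈ Set.Icc 0 (curveLength γ).toReal) :
    naturalParameterization γ Set.univ 0 t ∈ Set.range γ := by
  obtain ⟨b, rfl⟩ := exists_variation_eq γ hγ ht
  exact ⟨b, (naturalParameterization_variation γ hγ b).symm⟩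

/-- The distance between two points of a curve is at most the variation between them, which is the
difference of their arc-length parameters. -/
theorem lipschitzOnWith_naturalParameterization (hγ : curveLength γ ≠ ⊤) :
    LipschitzOnWith 1 (naturalParameterization γ Set.univ 0)
      (Set.Icc 0 (curveLength γ).toReal) := by
  have hb : BoundedVariationOn γ Set.univ := hγ
  have key : ∀ b c : unitInterval, b ≤ c → dist (γ b) (γ c) ≤
      dist (variationOnFromTo γ Set.univ 0 b) (variationOnFromTo γ Set.univ 0 c) := by
    intro b c hbc
    rw [dist_comm (variationOnFromTo _ _ _ _), Real.dist_eq,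
      variationOnFromTo.sub_right hb.locallyBoundedVariationOn (Set.mem_univ _) (Set.mem_univ _)
        (Set.mem_univ _), variationOnFromTo.eq_of_le _ _ hbc, ENNReal.abs_toReal]
    exact (hb.mono Set.inter_subset_left).dist_le ⟨Set.mem_univ _, Set.left_mem_Icc.2 hbc⟩
      ⟨Set.mem_univ _, Set.right_mem_Icc.2 hbc⟩
  refine LipschitzOnWith.of_dist_le_mul fun t ht t' ht' => ?_
  obtain ⟨b, rfl⟩ := exists_variation_eq γ hγ ht
  obtain ⟨c, rfl⟩ := exists_variation_eq γ hγ ht'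
  rw [naturalParameterization_variation γ hγ, naturalParameterization_variation γ hγ,
    NNReal.coe_one, one_mul]
  rcases le_total b c with h | h
  · exact key b c h
  · rw [dist_comm (γ b), dist_comm (variationOnFromTo _ _ _ b)]; exact key c b h

end ArcLength

/-! ### Distance to the boundary -/

section BoundaryDistance

variable {n : ℕ} {G : Set (EuclideanSpace ℝ (Fin n))}

theorem IsProperSubdomain.bdryDist_pos (hG : IsProperSubdomain G)
    {z : EuclideanSpace ℝ (Fin n)} (hz : z ∈ G) : 0 < bdryDist G z := by
  have hne : (frontier G).Nonempty := nonempty_frontier_iff.2 ⟨⟨z, hz⟩, hG.2.2⟩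
  refine (isClosed_frontier.notMem_iff_infDist_pos hne).1 fun h => ?_
  rw [hG.1.frontier_eq] at h
  exact h.2 hz

/-- The ball is connected and meets `G`, so leaving `G` would force it to meet the frontier, which
is too far away. -/
theorem IsProperSubdomain.ball_bdryDist_subset (hG : IsProperSubdomain G)
    {z : EuclideanSpace ℝ (Fin n)} (hz : z ∈ G) : Metric.ball z (bdryDist G z) ⊆ G := by
  refine (convex_ball z _).isPreconnected.subset_of_closure_inter_subset hG.1
    ⟨z, Metric.mem_ball_self (hG.bdryDist_pos hz), hz⟩ ?_
  rintro w ⟨hw, hwb⟩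
  by_contra hwG
  have : w ∈ frontier G := by rw [hG.1.frontier_eq]; exact ⟨hw, hwG⟩
  have h1 := Metric.infDist_le_dist_of_mem (x := z) this
  rw [Metric.mem_ball, dist_comm] at hwb
  exact absurd hwb (not_lt.2 h1)

end BoundaryDistance

/-! ### Logarithmic lower bounds for quasihyperbolic length -/

section LogIntegral

variable {g : ℝ → ℝ}

/-- Integrate the reciprocal of `g t ≤ g a + (t - a)`. -/
theorem log_le_integral_inv (hg : LipschitzWith 1 g) (hpos : ∀ t, 0 < g t) {a b : ℝ}
    (hab : a ≤ b) : Real.log (1 + (b - a) / g a) ≤ ∫ t in a..b, (g t)⁻¹ := by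
  have hga := hpos a
  have hinv : Continuous fun t => (g t)⁻¹ := hg.continuous.inv₀ fun t => (hpos t).ne'
  have h1 : ∫ t in a..b, (g a - a + t)⁻¹ = Real.log (1 + (b - a) / g a) := by
    rw [intervalIntegral.integral_comp_add_left (fun t => t⁻¹),
      integral_inv_of_pos (by linarith) (by linarith)]
    congr 1
    have : g a - a + a = g a := by ring
    rw [this]; field_simp; ring
  rw [← h1]
  refine intervalIntegral.integral_mono_on hab ?_ (hinv.intervalIntegrable _ _) ?_
  · refine ContinuousOn.intervalIntegrable (ContinuousOn.inv₀ (by fun_prop) ?_)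
    intro t ht
    rw [Set.uIcc_of_le hab] at ht
    linarith [ht.1]
  · intro t ht
    refine inv_anti₀ (hpos t) ?_
    have := hg.dist_le_mul t a
    rw [Real.dist_eq, Real.dist_eq, NNReal.coe_one, one_mul, abs_of_nonneg (sub_nonneg.2 ht.1)]
      at this
    linarith [(abs_le.1 this).2]

theorem log_le_integral_inv' (hg : LipschitzWith 1 g) (hpos : ∀ t, 0 < g t) {a b : ℝ}
    (hab : a ≤ b) : Real.log (1 + (b - a) / g b) ≤ ∫ t in a..b, (g t)⁻¹ := by
  have hg' : LipschitzWith 1 fun t => g (-t) := by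
    refine LipschitzWith.of_dist_le_mul fun t t' => ?_
    have := hg.dist_le_mul (-t) (-t')
    rwa [dist_neg_neg] at this
  have := log_le_integral_inv hg' (fun t => hpos (-t)) (neg_le_neg hab)
  rw [intervalIntegral.integral_comp_neg (fun t => (g t)⁻¹), neg_neg, neg_neg] at this
  convert this using 3
  ring

/-- With `g` the boundary distance along the curve, this is the source of the constant `log (1 +
s)`: the integral is at least `log (1 + |t - m| / g m)` on either side of `m`. -/
theorem dist_le_of_abs_integral_inv_le (hg : LipschitzWith 1 g) (hpos : ∀ t, 0 < g t) {s m t : ℝ}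
    (hs : 0 < s) (h : |∫ τ in m..t, (g τ)⁻¹| ≤ Real.log (1 + s)) : dist t m ≤ s * g m := by
  have key : ∀ d, 0 ≤ d → Real.log (1 + d / g m) ≤ Real.log (1 + s) → d ≤ s * g m := by
    intro d hd hl
    have hgm := hpos m
    have := (Real.log_le_log_iff (by positivity) (by positivity)).1 hl
    rw [← div_le_iff₀ hgm]
    linarith
  rcases le_total m t with hmt | hmt
  · rw [Real.dist_eq, abs_of_nonneg (sub_nonneg.2 hmt)]
    exact key _ (sub_nonneg.2 hmt)
      ((log_le_integral_inv hg hpos hmt).trans ((le_abs_self _).trans h))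
  · rw [dist_comm, Real.dist_eq, abs_of_nonneg (sub_nonneg.2 hmt)]
    rw [intervalIntegral.integral_symm, abs_neg] at h
    exact key _ (sub_nonneg.2 hmt)
      ((log_le_integral_inv' hg hpos hmt).trans ((le_abs_self _).trans h))

end LogIntegral

/-! ### The quasihyperbolic bound -/

section Quasihyperbolic

variable {n : ℕ} {G : Set (EuclideanSpace ℝ (Fin n))}

/-- The Harnack chain estimate along a `1`-Lipschitz curve. -/
theorem abs_log_sub_log_le_of_lipschitz (hG : IsProperSubdomain G) {s C : ℝ}
    (hs : s ∈ Set.Ioo (0 : ℝ) 1) (hC : 1 ≤ C) {u : EuclideanSpace ℝ (Fin n) → ℝ}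
    (hu : IsPositiveHarmonicOn G u) (hH : SatisfiesHarnack G s C u)
    {f : ℝ → EuclideanSpace ℝ (Fin n)} (hf : LipschitzWith 1 f) (hfG : ∀ t, f t ∈ G) {L : ℝ}
    (hL : 0 ≤ L) :
    |Real.log (u (f 0)) - Real.log (u (f L))| ≤
      (1 + (∫ t in 0..L, (bdryDist G (f t))⁻¹) / (2 * Real.log (1 + s))) * Real.log C := by
  set g : ℝ → ℝ := fun t => bdryDist G (f t) with hgdef
  have hg : LipschitzWith 1 g := by
    have h := (Metric.lipschitz_infDist_pt (frontier G)).comp hf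
    rw [one_mul] at h
    exact h
  have hpos : ∀ t, 0 < g t := fun t => hG.bdryDist_pos (hfG t)
  have hinv : Continuous fun t => (g t)⁻¹ := hg.continuous.inv₀ fun t => (hpos t).ne'
  have hint : ∀ a b, IntervalIntegrable (fun t => (g t)⁻¹) MeasureTheory.volume a b :=
    fun a b => hinv.intervalIntegrable a b
  -- `Φ` is quasihyperbolic length along the curve. `|Φ a - Φ b|` serves as the distance on the
  -- parameter line, where the intermediate value theorem splits it at any place.
  set Φ : ℝ → ℝ := fun t => ∫ τ in 0..t, (g τ)⁻¹ with hΦ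
  have hΦc : Continuous Φ := intervalIntegral.continuous_primitive hint 0
  have hΦsub : ∀ a b, Φ b - Φ a = ∫ τ in a..b, (g τ)⁻¹ := fun a b =>
    intervalIntegral.integral_interval_sub_left (hint _ _) (hint _ _)
  have hM : 0 < Real.log (1 + s) := Real.log_pos (by linarith [hs.1])
  have hIVT : ∀ a b v, v ∈ Set.uIcc (Φ a) (Φ b) → ∃ m, Φ m = v := fun a b v hv =>
    let ⟨m, _, hm⟩ := intermediate_value_uIcc hΦc.continuousOn hv
    ⟨m, hm⟩
  have hseg : ∀ a b t, 0 ≤ t → t ≤ |Φ a - Φ b| →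
      ∃ m, |Φ a - Φ m| = t ∧ |Φ m - Φ b| = |Φ a - Φ b| - t := by
    intro a b t h0 h1
    rcases le_total (Φ a) (Φ b) with h | h
    · rw [abs_of_nonpos (sub_nonpos.2 h)] at h1 ⊢
      obtain ⟨m, hm⟩ := hIVT a b (Φ a + t)
        (by rw [Set.uIcc_of_le h]; constructor <;> linarith)
      refine ⟨m, ?_, ?_⟩
      · rw [hm, abs_of_nonpos (by linarith)]; ring
      · rw [hm, abs_of_nonpos (by linarith)]; ring
    · rw [abs_of_nonneg (sub_nonneg.2 h)] at h1 ⊢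
      obtain ⟨m, hm⟩ := hIVT a b (Φ a - t)
        (by rw [Set.uIcc_of_ge h]; constructor <;> linarith)
      refine ⟨m, ?_, ?_⟩
      · rw [hm, abs_of_nonneg (by linarith)]; ring
      · rw [hm, abs_of_nonneg (by linarith)]; ring
  have hmain := abs_sub_le_one_add_div_mul (V := fun t => Real.log (u (f t)))
    (D := fun a b => |Φ a - Φ b|) (M := 2 * Real.log (1 + s)) (c := Real.log C) (by positivity)
    (Real.log_nonneg hC) (fun _ _ => abs_nonneg _) hseg ?_ 0 L
  · have h0 : Φ 0 = 0 := intervalIntegral.integral_same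
    have hΦL : 0 ≤ Φ L :=
      intervalIntegral.integral_nonneg hL fun t _ => (inv_pos.2 (hpos t)).le
    simpa only [h0, zero_sub, abs_neg, abs_of_nonneg hΦL] using hmain
  · intro a b hab
    obtain ⟨m, h1, h2⟩ := hseg a b (|Φ a - Φ b| / 2) (by positivity)
      (by linarith [abs_nonneg (Φ a - Φ b)])
    have mem : ∀ t, |Φ t - Φ m| ≤ Real.log (1 + s) →
        f t ∈ Metric.closedBall (f m) (s * bdryDist G (f m)) := by
      intro t ht
      rw [hΦsub] at ht
      have h3 := dist_le_of_abs_integral_inv_le hg hpos hs.1 ht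
      have h4 := hf.dist_le_mul t m
      rw [NNReal.coe_one, one_mul] at h4
      exact h4.trans h3
    refine hu.abs_log_sub_log_le hH hs (hG.bdryDist_pos (hfG m))
      (hG.ball_bdryDist_subset (hfG m)) (mem a (by linarith)) (mem b ?_)
    rw [abs_sub_comm]
    linarith

theorem abs_log_sub_log_le_lineIntegral (hG : IsProperSubdomain G) {s C : ℝ}
    (hs : s ∈ Set.Ioo (0 : ℝ) 1) (hC : 1 ≤ C) {u : EuclideanSpace ℝ (Fin n) → ℝ}
    (hu : IsPositiveHarmonicOn G u) (hH : SatisfiesHarnack G s C u)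
    {x y : EuclideanSpace ℝ (Fin n)} (γ : Path x y) (hγG : Set.range γ ⊆ G)
    (hγ : curveLength γ ≠ ⊤) :
    ENNReal.ofReal |Real.log (u x) - Real.log (u y)| ≤
      (1 + lineIntegral (fun z => (ENNReal.ofReal (bdryDist G z))⁻¹) γ /
        ENNReal.ofReal (2 * Real.log (1 + s))) * ENNReal.ofReal (Real.log C) := by
  set L := (curveLength γ).toReal with hLdef
  have hL : 0 ≤ L := ENNReal.toReal_nonneg
  have hM : 0 < 2 * Real.log (1 + s) :=
    mul_pos two_pos (Real.log_pos (by linarith [hs.1]))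
  set φ := naturalParameterization γ Set.univ 0 with hφ
  -- Extending `φ` by its end values makes it `1`-Lipschitz with values in `G` on all of `ℝ`.
  set f : ℝ → EuclideanSpace ℝ (Fin n) := fun t => φ (Set.projIcc 0 L hL t) with hfdef
  have hfφ : ∀ t ∈ Set.Icc 0 L, f t = φ t := fun t ht => by
    rw [hfdef]; simp only [Set.projIcc_of_mem hL ht]
  have hf : LipschitzWith 1 f := by
    have h := (lipschitzOnWith_iff_restrict.1
      (lipschitzOnWith_naturalParameterization γ hγ)).comp (LipschitzWith.projIcc hL)
    rw [one_mul] at h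
    exact h
  have hfG : ∀ t, f t ∈ G := fun t =>
    hγG (naturalParameterization_mem_range γ hγ (Set.projIcc 0 L hL t).2)
  have hmain := abs_log_sub_log_le_of_lipschitz hG hs hC hu hH hf hfG hL
  rw [hfφ 0 ⟨le_rfl, hL⟩, hfφ L ⟨hL, le_rfl⟩, hφ, naturalParameterization_zero γ hγ,
    naturalParameterization_length γ hγ] at hmain
  have hpos : ∀ t, 0 < bdryDist G (f t) := fun t => hG.bdryDist_pos (hfG t)
  have hcont : Continuous fun t => (bdryDist G (f t))⁻¹ :=
    ((Metric.continuous_infDist_pt (frontier G)).comp hf.continuous).inv₀ fun t => (hpos t).ne'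
  have hI : 0 ≤ ∫ t in 0..L, (bdryDist G (f t))⁻¹ :=
    intervalIntegral.integral_nonneg hL fun t _ => (inv_pos.2 (hpos t)).le
  have hline : lineIntegral (fun z => (ENNReal.ofReal (bdryDist G z))⁻¹) γ =
      ENNReal.ofReal (∫ t in 0..L, (bdryDist G (f t))⁻¹) := by
    rw [intervalIntegral.integral_of_le hL, ← MeasureTheory.integral_Icc_eq_integral_Ioc,
      MeasureTheory.ofReal_integral_eq_lintegral_ofReal
        (hcont.continuousOn.integrableOn_compact isCompact_Icc)
        (Filter.Eventually.of_forall fun t => (inv_pos.2 (hpos t)).le)]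
    refine MeasureTheory.setLIntegral_congr_fun measurableSet_Icc fun t ht => ?_
    change (ENNReal.ofReal (bdryDist G (φ t)))⁻¹ = _
    rw [← hfφ t ht, ENNReal.ofReal_inv_of_pos (hpos t)]
  rw [hline, ← ENNReal.ofReal_div_of_pos hM, ← ENNReal.ofReal_one,
    ← ENNReal.ofReal_add zero_le_one (by positivity), ← ENNReal.ofReal_mul (by positivity)]
  exact ENNReal.ofReal_le_ofReal hmain

/-- The case `C = 1` needs its own argument, because the extended bound is then `0` even if the
distance is `⊤`. Here `log u` is locally constant on the connected set `G`. -/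
theorem log_eq_log_of_harnack_one (hG : IsProperSubdomain G) {s C : ℝ}
    (hs : s ∈ Set.Ioo (0 : ℝ) 1) (hC : Real.log C = 0) {u : EuclideanSpace ℝ (Fin n) → ℝ}
    (hu : IsPositiveHarmonicOn G u) (hH : SatisfiesHarnack G s C u)
    {x y : EuclideanSpace ℝ (Fin n)} (hx : x ∈ G) (hy : y ∈ G) :
    Real.log (u x) = Real.log (u y) := by
  refine hG.2.1.isPreconnected.induction₂ (fun a b => Real.log (u a) = Real.log (u b)) ?_
    (fun _ _ _ _ _ _ h h' => h.trans h') (fun _ _ _ _ h => h.symm) hx hy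
  intro a ha
  have hd := hG.bdryDist_pos ha
  have hr : 0 < s * bdryDist G a := mul_pos hs.1 hd
  filter_upwards [mem_nhdsWithin_of_mem_nhds (Metric.closedBall_mem_nhds a hr)] with b hb
  have := hu.abs_log_sub_log_le hH hs hd (hG.ball_bdryDist_subset ha)
    (Metric.mem_closedBall_self hr.le) hb
  rw [hC] at this
  exact sub_eq_zero.1 (abs_nonpos_iff.1 this)

theorem harnackDist_le_quasihypDist (hG : IsProperSubdomain G) {s C : ℝ}
    (hs : s ∈ Set.Ioo (0 : ℝ) 1) (hC : 1 ≤ C)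
    (hH : ∀ u, IsPositiveHarmonicOn G u → SatisfiesHarnack G s C u)
    {x y : EuclideanSpace ℝ (Fin n)} (hx : x ∈ G) (hy : y ∈ G) :
    harnackDist G x y ≤
      (1 + quasihypDist G x y / ENNReal.ofReal (2 * Real.log (1 + s))) *
        ENNReal.ofReal (Real.log C) := by
  refine harnackDist_le hx hy fun u hu => ?_
  rcases (Real.log_nonneg hC).eq_or_lt with h0 | h0
  · rw [log_eq_log_of_harnack_one hG hs h0.symm hu (hH u hu) hx hy]
    simp
  have hM : 0 < 2 * Real.log (1 + s) :=
    mul_pos two_pos (Real.log_pos (by linarith [hs.1]))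
  -- Solving for `K` isolates the infimum over curves, so that each curve can be treated alone;
  -- dividing by `log C` requires `C ≠ 1`.
  have hiff : ∀ B K : ℝ≥0∞, B ≤ (1 + K / ENNReal.ofReal (2 * Real.log (1 + s))) *
      ENNReal.ofReal (Real.log C) ↔
      (B / ENNReal.ofReal (Real.log C) - 1) * ENNReal.ofReal (2 * Real.log (1 + s)) ≤ K := by
    intro B K
    rw [← ENNReal.div_le_iff (ENNReal.ofReal_pos.2 h0).ne' ENNReal.ofReal_ne_top,
      ← tsub_le_iff_left, ENNReal.le_div_iff_mul_le (Or.inl (ENNReal.ofReal_pos.2 hM).ne')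
        (Or.inl ENNReal.ofReal_ne_top)]
  rw [hiff]
  refine le_iInf fun γ => le_iInf fun hγG => le_iInf fun hγ => ?_
  rw [← hiff]
  exact abs_log_sub_log_le_lineIntegral hG hs hC hu (hH u hu) γ hγG hγ

end Quasihyperbolic

end HarnackMetric

theorem mainTheorem8 (n : ℕ) (hn : 2 ≤ n) (s C : ℝ) (hs : s ∈ Set.Ioo (0 : ℝ) 1) (hC : 1 ≤ C) :
    (∀ G : Set (EuclideanSpace ℝ (Fin n)), HarnackMetric.IsProperSubdomain G →
      (∀ u, HarnackMetric.IsPositiveHarmonicOn G u → HarnackMetric.SatisfiesHarnack G s C u) →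
      ∀ x ∈ G, ∀ y ∈ G,
        HarnackMetric.harnackDist G x y ≤
          (1 + HarnackMetric.quasihypDist G x y / ENNReal.ofReal (2 * Real.log (1 + s))) *
            ENNReal.ofReal (Real.log C)) ∧
    ((∀ u, HarnackMetric.IsPositiveHarmonicOn (HarnackMetric.unitBall n) u →
        HarnackMetric.SatisfiesHarnack (HarnackMetric.unitBall n) s C u) →
      ∀ x ∈ HarnackMetric.unitBall n, ∀ y ∈ HarnackMetric.unitBall n,
        HarnackMetric.harnackDist (HarnackMetric.unitBall n) x y ≤
          ENNReal.ofReal ((1 + HarnackMetric.hypDistBall x y / Real.log ((1 + s) / (1 - s))) *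
            Real.log C)) ∧
    ((∀ u, HarnackMetric.IsPositiveHarmonicOn (HarnackMetric.halfSpace n hn) u →
        HarnackMetric.SatisfiesHarnack (HarnackMetric.halfSpace n hn) s C u) →
      ∀ x ∈ HarnackMetric.halfSpace n hn, ∀ y ∈ HarnackMetric.halfSpace n hn,
        HarnackMetric.harnackDist (HarnackMetric.halfSpace n hn) x y ≤
          ENNReal.ofReal ((1 + HarnackMetric.hypDistHalfSpace hn x y /
            Real.log ((1 + s) / (1 - s))) * Real.log C)) := by
  refine ⟨fun G hG hH x hx y hy => ?_, fun hH x hx y hy => ?_, fun hH x hx y hy => ?_⟩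
  · exact HarnackMetric.harnackDist_le_quasihypDist hG hs hC hH hx hy
  · exact HarnackMetric.harnackDist_unitBall_le hs hC hH hx hy
  · exact HarnackMetric.harnackDist_halfSpace_le hn hs hC hH hx hy
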